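/- Let $L^2=L^2(0,1)$ with inner product $(\cdot,\cdot)$ and norm $\|\cdot\|$; let $H^1_{per}$ be the space of all $u\in L^2$ that have a weak derivative $u_x\in L^2$ in the $1$-periodic sense, i.e. $\int_0^1 u\,\varphi'\,dx=-\int_0^1 u_x\,\varphi\,dx$ for every smooth $1$-periodic $\varphi$, with norm $(\|u\|^2+\|u_x\|^2)^{1/2}$ and dual $(H^1_{per})'$; and let $\dot H^1$ be the closed subspace of $H^1_{per}$ of functions with mean zero, with the (equivalent) norm $\|u\|_{\dot H^1}=\|u_x\|$. As usual $L^2\subset (H^1_{per})'$ via $\langle u,z\rangle=(u,z)$. Let $a\in C_b([0,\infty);\dot H^1)$ with $\|a(\tau)\|_{\dot H^1}\le M$ for every $\tau\ge 0$, let $y_0\in L^\infty(0,1)$, and let $y\in L^2_{loc}(0,\infty;H^1_{per})\cap C([0,\infty);L^2)$ with weak time derivative $y_\tau\in L^2_{loc}(0,\infty;(H^1_{per})')$ be a weak solution of the linear periodic problem $$ \begin{aligned} & y_\tau - y_{xx} - a\,y_x = 0 && \text{in } (0,1)\times(0,\infty),\\ & y(0,\tau)=y(1,\tau),\quad y_x(0,\tau)=y_x(1,\tau)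 && \text{for } \tau>0,\\ & y(0)=y_0, \end{aligned} $$ that is, $y(0)=y_0$ and, for almost every $\tau>0$, $$ \langle y_\tau(\tau),z\rangle+(y_x(\tau),z_x)-(a(\tau)y_x(\tau),z)=0\qquad\text{for every } z\in H^1_{per}. $$ Then $$ \|y(\tau)\|_{L^\infty(0,1)}\le\|y_0\|_{L^\infty(0,1)}\qquad\text{for every }\tau\ge 0 . $$ -/

import Mathlib

open MeasureTheory Set Filter Topology
open scoped ContDiff

noncomputable section

/-- Lebesgue measure on the unit interval `(0,1)`. -/
abbrev unitMeasure : Measure ℝ := volume.restrict (Ioo (0 : ℝ) 1)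

/-- The space `L² = L²(0,1)`. -/
abbrev L2 : Type := Lp ℝ 2 unitMeasure

/-- `g` is the weak derivative of `u` in the `1`-periodic sense: the integration by parts formula
holds against every smooth `1`-periodic test function. -/
def IsPeriodicWeakDeriv (u g : L2) : Prop :=
  ∀ φ : ℝ → ℝ, ContDiff ℝ ∞ φ → Function.Periodic φ 1 →
    ∫ x in Ioo (0 : ℝ) 1, u x * deriv φ x = -∫ x in Ioo (0 : ℝ) 1, g x * φ x

lemma integrable_L2_mul_continuous (u : L2) {ψ : ℝ → ℝ} (hψ : Continuous ψ) :
    Integrable (fun x => u x * ψ x) unitMeasure := by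
  have hu : Integrable u unitMeasure := (Lp.memLp u).integrable (by norm_num)
  obtain ⟨C, hC⟩ := (isCompact_Icc (a := (0 : ℝ)) (b := 1)).exists_bound_of_continuousOn
    hψ.continuousOn
  refine hu.mul_bdd (c := C) hψ.aestronglyMeasurable ?_
  filter_upwards [ae_restrict_mem measurableSet_Ioo] with x hx
  exact hC x (Ioo_subset_Icc_self hx)

lemma integral_L2_add_mul (u v : L2) {ψ : ℝ → ℝ} (hψ : Continuous ψ) :
    ∫ x in Ioo (0 : ℝ) 1, (u + v : L2) x * ψ x =
      (∫ x in Ioo (0 : ℝ) 1, u x * ψ x) + ∫ x in Ioo (0 : ℝ) 1, v x * ψ x := by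
  rw [← integral_add (integrable_L2_mul_continuous u hψ) (integrable_L2_mul_continuous v hψ)]
  refine integral_congr_ae ?_
  filter_upwards [Lp.coeFn_add u v] with x hx
  rw [hx, Pi.add_apply, add_mul]

lemma integral_L2_smul_mul (c : ℝ) (u : L2) (ψ : ℝ → ℝ) :
    ∫ x in Ioo (0 : ℝ) 1, (c • u : L2) x * ψ x = c * ∫ x in Ioo (0 : ℝ) 1, u x * ψ x := by
  rw [← integral_const_mul]
  refine integral_congr_ae ?_
  filter_upwards [Lp.coeFn_smul c u] with x hx
  simp [hx, mul_assoc]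

lemma integral_L2_zero_mul (ψ : ℝ → ℝ) :
    ∫ x in Ioo (0 : ℝ) 1, (0 : L2) x * ψ x = 0 := by
  have h := integral_L2_smul_mul 0 0 ψ
  simpa using h

/-- The space `H¹_per`: functions `u ∈ L²` with a periodic weak derivative `u_x ∈ L²`. It is
realised as the space of pairs `(u, u_x)` in the Hilbert sum `L² ⊕ L²` (the weak derivative is
determined by `u`), so that `‖u‖²_{H¹} = ‖u‖² + ‖u_x‖²`. -/
def H1per : Submodule ℝ (WithLp 2 (L2 × L2)) where
  carrier := {p | IsPeriodicWeakDeriv p.fst p.snd}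
  zero_mem' := by
    intro φ _ _
    simp only [WithLp.zero_fst, WithLp.zero_snd]
    rw [integral_L2_zero_mul, integral_L2_zero_mul, neg_zero]
  add_mem' := by
    intro p q hp hq φ hφ hper
    have h1 : Continuous (deriv φ) := hφ.continuous_deriv (by simp)
    simp only [WithLp.add_fst, WithLp.add_snd]
    rw [integral_L2_add_mul _ _ h1, integral_L2_add_mul _ _ hφ.continuous,
      hp φ hφ hper, hq φ hφ hper]
    ring
  smul_mem' := by
    intro c p hp φ hφ hper
    simp only [WithLp.smul_fst, WithLp.smul_snd]
    rw [integral_L2_smul_mul, integral_L2_smul_mul, hp φ hφ hper]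
    ring

/-- The inclusion `H¹_per → L²`, `u ↦ u`. -/
def H1per.toL2 : H1per →L[ℝ] L2 :=
  (WithLp.fstL 2 ℝ L2 L2).comp H1per.subtypeL

/-- The weak derivative `H¹_per → L²`, `u ↦ u_x`. -/
def H1per.dx : H1per →L[ℝ] L2 :=
  (WithLp.sndL 2 ℝ L2 L2).comp H1per.subtypeL

/-- The space `Ḣ¹` of the functions in `H¹_per` with mean zero, a closed subspace of `H¹_per`.
On it the norm of `H¹_per` is equivalent, by the Poincaré inequality, to `‖u_x‖`. -/
def Hdot1 : Submodule ℝ H1per where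
  carrier := {u | ∫ x in Ioo (0 : ℝ) 1, H1per.toL2 u x = 0}
  zero_mem' := by
    have h := integral_L2_zero_mul (fun _ => 1)
    simpa using h
  add_mem' := by
    intro u v hu hv
    have h := integral_L2_add_mul (H1per.toL2 u) (H1per.toL2 v) (ψ := fun _ => 1) continuous_const
    simp only [mul_one, mem_ofPred_eq, map_add] at *
    rw [h, hu, hv, add_zero]
  smul_mem' := by
    intro c u hu
    have h := integral_L2_smul_mul c (H1per.toL2 u) (fun _ => 1)
    simp only [mul_one, mem_ofPred_eq, map_smul] at *
    rw [h, hu, mul_zero]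

/-- The norm `‖u‖_{Ḣ¹} = ‖u_x‖_{L²}` of `Ḣ¹`. -/
def Hdot1.homNorm (u : Hdot1) : ℝ := ‖H1per.dx (u : H1per)‖

/-- The embedding `L² → (H¹_per)'` of the Gelfand triple `H¹_per ⊆ L² ⊆ (H¹_per)'`:
`⟨u, z⟩ = (u, z)_{L²}`. -/
def toDualH1per (u : L2) : StrongDual ℝ H1per :=
  (innerSL ℝ u).comp H1per.toL2

/-- `f ∈ L²_loc(0,∞; E)`: `f` is Bochner square integrable on the compact subintervals
of `(0,∞)`. -/
def MemL2loc {E : Type*} [NormedAddCommGroup E] (f : ℝ → E) : Prop :=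
  ∀ s t : ℝ, 0 < s → s < t → MemLp f 2 (volume.restrict (Icc s t))

/-- `g` is the weak (distributional) time derivative of `f` on `(0,∞)`. -/
def IsWeakTimeDeriv {E : Type*} [NormedAddCommGroup E] [NormedSpace ℝ E] (f g : ℝ → E) : Prop :=
  ∀ φ : ℝ → ℝ, ContDiff ℝ ∞ φ → HasCompactSupport φ → tsupport φ ⊆ Ioi 0 →
    ∫ t in Ioi (0 : ℝ), deriv φ t • f t = -∫ t in Ioi (0 : ℝ), φ t • g t

/-- `y` is a weak solution of the periodic problem `y_τ - y_xx - a y_x = 0` on `(0,1) × (0,∞)`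
with `y(0) = y₀`: one has `y ∈ C([0,∞); L²) ∩ L²_loc(0,∞; H¹_per)` (`Y` is `y` as an
`H¹_per`-valued function), the time derivative `D = y_τ` is in `L²_loc(0,∞; (H¹_per)')`, and for
almost every `τ > 0`, `⟨y_τ, z⟩ + (y_x, z_x) - (a y_x, z) = 0` for every `z ∈ H¹_per`.
The functions of time are only relevant on `[0,∞)`. -/
def IsWeakSolution (a : ℝ → Hdot1) (y₀ : L2) (y : ℝ → L2) : Prop :=
  ContinuousOn y (Ici 0) ∧ y 0 = y₀ ∧
  ∃ (Y : ℝ → H1per) (D : ℝ → StrongDual ℝ H1per),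
    MemL2loc Y ∧ (∀ᵐ τ ∂(volume.restrict (Ioi (0 : ℝ))), H1per.toL2 (Y τ) = y τ) ∧
    MemL2loc D ∧ IsWeakTimeDeriv (fun τ => toDualH1per (y τ)) D ∧
    ∀ᵐ τ ∂(volume.restrict (Ioi (0 : ℝ))), ∀ z : H1per,
      D τ z + inner ℝ (H1per.dx (Y τ)) (H1per.dx z)
        - ∫ x in Ioo (0 : ℝ) 1,
            H1per.toL2 (a τ : H1per) x * H1per.dx (Y τ) x * H1per.toL2 z x = 0

end

/-!
The bound is proved one side at a time: if `y₀ ≤ k` with `k ≥ 0`, then `y τ ≤ k` for all `τ ≥ 0`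
(`IsWeakSolution.ae_le`), and the lower bound is this statement for the weak solution `-y`.

Formally one tests the equation with `(y - k)⁺`, absorbs the transport term in the diffusion, and
applies Gronwall's inequality. Here `(y - k)⁺` is replaced by a `C^{1,1}` regularisation
`β = truncation k`, with slope `γ = ramp k` and primitive `Φ = entropy k`. For this choice
`u ↦ β(u)` is a continuous map of `H1per` into itself (`H1per.continuous_trunc`), so that
`t ↦ β(y(t))` is a strongly measurable, square integrable `H1per`-valued test function. The
monotonicity of `γ` yields `β² ≤ 2 γ Φ` (`truncation_sq_le`), whence
`-γ y_x² + a y_x β ≤ ‖a‖²_∞ Φ / 2`, which is the absorption of the transport term.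

The spatial facts (chain rule for `β(u)`, embedding into `L^∞`) come from the absolutely continuous
representative of a function in `H1per`, obtained from the lemma of du Bois-Reymond
(`ae_eq_const_add_integral_of_weakDeriv`).

The functional `F(t) = ∫ Φ(y(t))` is not known to be differentiable, and no chain rule in the
Gelfand triple is used. Instead, convexity of `Φ` and the weak time derivative `D` give
`F(t) - F(t - h) ≤ (y(t) - y(t - h), β(y(t))) = ∫_{t-h}^t ⟨D(r), β(y(t))⟩ dr`.
Integrating over `t ∈ [s, T]`, dividing by `h` and letting `h → 0`, where translations are
continuous in `L²`, one finds `F(T) - F(s) ≤ ∫_s^T ⟨D(t), β(y(t))⟩ dt` (`sub_le_integral_pairing`).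
The equation bounds the right-hand side by a multiple of `∫_s^T F`; the continuity of `y` at `0`
permits `s → 0`, and `F(0) = 0` forces `F = 0`.
-/

/-! ### Absolutely continuous functions and weak derivatives on an interval -/

/-- Composition with a Lipschitz function preserves absolute continuity. -/
lemma LipschitzWith.comp_absolutelyContinuousOnInterval {β U : ℝ → ℝ} {K : NNReal} {a b : ℝ}
    (hβ : LipschitzWith K β) (hU : AbsolutelyContinuousOnInterval U a b) :
    AbsolutelyContinuousOnInterval (fun x => β (U x)) a b := by
  have h := Tendsto.const_mul (K : ℝ) hU
  rw [mul_zero] at h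
  refine squeeze_zero (fun E => Finset.sum_nonneg fun _ _ => dist_nonneg) (fun E => ?_) h
  rw [Finset.mul_sum]
  exact Finset.sum_le_sum fun i _ => hβ.dist_le_mul _ _

lemma absolutelyContinuousOnInterval_const_add_integral {g : ℝ → ℝ} {a b : ℝ} (c : ℝ)
    (hg : IntervalIntegrable g volume a b) :
    AbsolutelyContinuousOnInterval (fun x => c + ∫ t in a..x, g t) a b := by
  have h1 : AbsolutelyContinuousOnInterval (fun _ : ℝ => c) a b :=
    ((LipschitzWith.const c).lipschitzOnWith).absolutelyContinuousOnInterval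
  exact h1.add (hg.absolutelyContinuousOnInterval_intervalIntegral left_mem_uIcc)

lemma ae_hasDerivAt_const_add_integral {g : ℝ → ℝ} {a b : ℝ} (c : ℝ)
    (hg : IntervalIntegrable g volume a b) :
    ∀ᵐ x, x ∈ uIcc a b → HasDerivAt (fun x => c + ∫ t in a..x, g t) (g x) x := by
  filter_upwards [hg.ae_hasDerivAt_integral] with x hx hxm
  exact (hx hxm a left_mem_uIcc).const_add c

/-- Integration by parts when only one factor is smooth and the other one is absolutely continuous
with a prescribed almost everywhere derivative. -/
lemma AbsolutelyContinuousOnInterval.integral_mul_deriv_of_ae_hasDerivAt {f f' φ : ℝ → ℝ} {a b : ℝ}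
    (hf : AbsolutelyContinuousOnInterval f a b)
    (hf' : ∀ᵐ x, x ∈ uIcc a b → HasDerivAt f (f' x) x) (hφ : ContDiff ℝ ∞ φ) :
    ∫ x in a..b, f x * deriv φ x = f b * φ b - f a * φ a - ∫ x in a..b, f' x * φ x := by
  have hφ' : AbsolutelyContinuousOnInterval φ a b :=
    (hφ.of_le (by simp)).contDiffOn.absolutelyContinuousOnInterval
  rw [hf.integral_mul_deriv_eq_deriv_mul hφ']
  congr 1
  refine intervalIntegral.integral_congr_ae ?_
  filter_upwards [hf'] with x hx hxm
  rw [(hx (uIoc_subset_uIcc hxm)).deriv]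

/-- A primitive of a mean-zero test function is again a test function. -/
lemma exists_primitive_of_integral_eq_zero {a b : ℝ} {ψ : ℝ → ℝ}
    (hψ : ContDiff ℝ ∞ ψ) (hc : HasCompactSupport ψ) (hs : tsupport ψ ⊆ Ioo a b)
    (h0 : ∫ x, ψ x = 0) :
    ∃ φ : ℝ → ℝ, ContDiff ℝ ∞ φ ∧ HasCompactSupport φ ∧ tsupport φ ⊆ Ioo a b ∧ deriv φ = ψ := by
  have hd : ∀ x, HasDerivAt (fun x => ∫ t in a..x, ψ t) (ψ x) x := fun x =>
    intervalIntegral.integral_hasDerivAt_right (hψ.continuous.intervalIntegrable _ _)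
      hψ.continuous.aestronglyMeasurable.stronglyMeasurableAtFilter hψ.continuous.continuousAt
  have hder : deriv (fun x => ∫ t in a..x, ψ t) = ψ := funext fun x => (hd x).deriv
  -- The support of `ψ` lies in some `[a', b'] ⊆ (a, b)`.
  obtain ⟨a', b', hab', hsub⟩ : ∃ a' b', Icc a' b' ⊆ Ioo a b ∧ tsupport ψ ⊆ Icc a' b' := by
    rcases (tsupport ψ).eq_empty_or_nonempty with he | hne
    · exact ⟨1, 0, by simp, by simp [he]⟩
    · have hK : IsCompact (tsupport ψ) := hc
      refine ⟨sInf (tsupport ψ), sSup (tsupport ψ), ?_, ?_⟩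
      · exact (Icc_subset_Ioo (hs (hK.sInf_mem hne)).1 (hs (hK.sSup_mem hne)).2)
      · exact fun x hx => ⟨csInf_le hK.bddBelow hx, le_csSup hK.bddAbove hx⟩
  have hz : ∀ x, x ∉ Icc a' b' → ψ x = 0 := fun x hx => by
    by_contra h
    exact hx (hsub (subset_tsupport ψ h))
  have hsup : Function.support (fun x => ∫ t in a..x, ψ t) ⊆ Icc a' b' := by
    intro x hx
    by_contra hxn
    apply hx
    rw [mem_Icc, not_and_or, not_le, not_le] at hxn
    have hout : ∀ t, t ∉ Ioo a b → ψ t = 0 := fun t ht => hz t fun h => ht (hab' h)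
    rcases hxn with hxn | hxn
    · refine (intervalIntegral.integral_congr_ae (g := fun _ => 0) ?_).trans (by simp)
      refine .of_forall fun t ht => ?_
      rcases le_total a x with hax | hax
      · rw [uIoc_of_le hax] at ht
        exact hz t fun h => absurd (h.1.trans ht.2) (not_le.2 hxn)
      · rw [uIoc_of_ge hax] at ht
        exact hout t fun h => absurd ht.2 (not_le.2 h.1)
    · have h1 : ∫ t in a..x, ψ t = ∫ t, ψ t := by
        apply intervalIntegral.integral_eq_integral_of_support_subset
        intro t ht
        have ht1 : t ∈ Icc a' b' := by
          by_contra h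
          exact ht (hz t h)
        exact ⟨(hab' ht1).1, ht1.2.trans hxn.le⟩
      exact h1.trans h0
  have hts : tsupport (fun x => ∫ t in a..x, ψ t) ⊆ Icc a' b' := closure_minimal hsup isClosed_Icc
  refine ⟨fun x => ∫ t in a..x, ψ t, ?_, ?_, hts.trans hab', hder⟩
  · rw [contDiff_infty_iff_deriv, hder]
    exact ⟨fun x => (hd x).differentiableAt, hψ⟩
  · exact isCompact_Icc.of_isClosed_subset (isClosed_tsupport _) hts

lemma exists_testFunction_integral_eq_one {a b : ℝ} (hab : a < b) :
    ∃ ψ : ℝ → ℝ, ContDiff ℝ ∞ ψ ∧ HasCompactSupport ψ ∧ tsupport ψ ⊆ Ioo a b ∧ ∫ x, ψ x = 1 := by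
  let f : ContDiffBump ((a + b) / 2) := ⟨(b - a) / 8, (b - a) / 4, by linarith, by linarith⟩
  refine ⟨f.normed volume, f.contDiff_normed, f.hasCompactSupport_normed, ?_, f.integral_normed⟩
  rw [f.tsupport_normed_eq, Real.closedBall_eq_Icc]
  have : f.rOut = (b - a) / 4 := rfl
  exact Icc_subset_Ioo (by rw [this]; linarith) (by rw [this]; linarith)

/-- The lemma of du Bois-Reymond: an integrable function with an integrable weak derivative `g` on
a bounded interval is almost everywhere a primitive of `g`. -/
lemma ae_eq_const_add_integral_of_weakDeriv {a b : ℝ} (hab : a < b) {f g : ℝ → ℝ}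
    (hf : IntegrableOn f (Ioo a b)) (hg : IntegrableOn g (Ioo a b))
    (h : ∀ φ : ℝ → ℝ, ContDiff ℝ ∞ φ → HasCompactSupport φ → tsupport φ ⊆ Ioo a b →
      ∫ x in Ioo a b, f x * deriv φ x = -∫ x in Ioo a b, g x * φ x) :
    ∃ c, ∀ᵐ x ∂(volume.restrict (Ioo a b)), f x = c + ∫ t in a..x, g t := by
  have hgi : IntervalIntegrable g volume a b :=
    (intervalIntegrable_iff_integrableOn_Ioo_of_le hab.le).2 hg
  set V : ℝ → ℝ := fun x => 0 + ∫ t in a..x, g t with hV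
  have hVac : AbsolutelyContinuousOnInterval V a b :=
    absolutelyContinuousOnInterval_const_add_integral 0 hgi
  have hVi : IntegrableOn V (Ioo a b) := by
    refine (ContinuousOn.integrableOn_compact isCompact_Icc ?_).mono_set Ioo_subset_Icc_self
    simpa [uIcc_of_le hab.le] using hVac.continuousOn
  set v : ℝ → ℝ := fun x => f x - V x with hv
  have hvi : IntegrableOn v (Ioo a b) := hf.sub hVi
  have hmul : ∀ {u ψ : ℝ → ℝ}, IntegrableOn u (Ioo a b) → Continuous ψ → HasCompactSupport ψ →
      IntegrableOn (fun x => u x * ψ x) (Ioo a b) := by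
    intro u ψ hu hψ hc
    obtain ⟨C, hC⟩ := hψ.bounded_above_of_compact_support hc
    exact hu.mul_bdd (c := C) hψ.aestronglyMeasurable (.of_forall hC)
  -- `v` is orthogonal to all derivatives of test functions.
  have hvφ : ∀ φ : ℝ → ℝ, ContDiff ℝ ∞ φ → HasCompactSupport φ → tsupport φ ⊆ Ioo a b →
      ∫ x in Ioo a b, v x * deriv φ x = 0 := by
    intro φ hφ hc hs
    have hb : ∀ x, x ∉ Ioo a b → φ x = 0 := fun x hx => by
      by_contra h
      exact hx (hs (subset_tsupport φ h))
    have hcd : Continuous (deriv φ) := hφ.continuous_deriv (by simp)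
    have h1 : ∫ x in Ioo a b, V x * deriv φ x = -∫ x in Ioo a b, g x * φ x := by
      have h2 := hVac.integral_mul_deriv_of_ae_hasDerivAt
        (ae_hasDerivAt_const_add_integral 0 hgi) hφ
      rw [hb a (by simp), hb b (by simp), mul_zero, mul_zero, sub_zero, zero_sub,
        intervalIntegral.integral_of_le hab.le, intervalIntegral.integral_of_le hab.le,
        integral_Ioc_eq_integral_Ioo, integral_Ioc_eq_integral_Ioo] at h2
      exact h2
    simp only [hv, sub_mul]
    rw [integral_sub (hmul hf hcd hc.deriv) (hmul hVi hcd hc.deriv), h φ hφ hc hs, h1, sub_self]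
  obtain ⟨ψ₀, hψ₀, hc₀, hs₀, hi₀⟩ := exists_testFunction_integral_eq_one hab
  set c : ℝ := ∫ x in Ioo a b, v x * ψ₀ x with hc
  refine ⟨c, ?_⟩
  have key : ∀ᵐ x, x ∈ Ioo a b → v x - c = 0 := by
    refine isOpen_Ioo.ae_eq_zero_of_integral_contDiff_smul_eq_zero
      ((hvi.sub (integrableOn_const (by simp))).locallyIntegrableOn) ?_
    intro ψ hψ hψc hψs
    have hη := exists_primitive_of_integral_eq_zero (a := a) (b := b)
      (ψ := fun x => ψ x - (∫ t, ψ t) * ψ₀ x) (hψ.sub (contDiff_const.mul hψ₀))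
      (hψc.sub hc₀.mul_left)
      ((tsupport_sub ψ (fun x => (∫ t, ψ t) * ψ₀ x)).trans
        (union_subset hψs ((tsupport_mul_subset_right).trans hs₀)))
      (by
        rw [integral_sub (hψ.continuous.integrable_of_hasCompactSupport hψc)
          ((hψ₀.continuous.integrable_of_hasCompactSupport hc₀).const_mul _),
          integral_const_mul, hi₀, mul_one, sub_self])
    obtain ⟨φ, hφ, hφc, hφs, hφd⟩ := hη
    have h1 := hvφ φ hφ hφc hφs
    have e : ∀ x, v x * deriv φ x = v x * ψ x - (∫ t, ψ t) * (v x * ψ₀ x) := fun x => by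
      rw [hφd]; ring
    simp only [e] at h1
    rw [integral_sub (hmul hvi hψ.continuous hψc) ((hmul hvi hψ₀.continuous hc₀).const_mul _),
      integral_const_mul, ← hc] at h1
    have hz : ∀ x, x ∉ Ioo a b → ψ x = 0 := fun x hx => by
      by_contra h
      exact hx (hψs (subset_tsupport ψ h))
    have h2 : ∫ x, ψ x • (v x - c) = ∫ x in Ioo a b, (v x * ψ x - c * ψ x) := by
      rw [← setIntegral_eq_integral_of_forall_compl_eq_zero (s := Ioo a b)
        (fun x hx => by rw [hz x hx, zero_smul])]
      refine integral_congr_ae (.of_forall fun x => ?_)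
      simp only [smul_eq_mul]
      ring
    have h3 : ∫ x in Ioo a b, ψ x = ∫ x, ψ x :=
      setIntegral_eq_integral_of_forall_compl_eq_zero hz
    rw [h2, integral_sub (hmul hvi hψ.continuous hψc)
      ((hψ.continuous.integrable_of_hasCompactSupport hψc).integrableOn.const_mul _),
      integral_const_mul, h3]
    linarith
  rw [ae_restrict_iff' measurableSet_Ioo]
  filter_upwards [key] with x hx hxm
  have := hx hxm
  simp only [hv, hV] at this
  linarith

/-! ### Functions in `H1per` -/

/-- The `1`-periodic extension of a test function on `(0,1)` is smooth. -/
lemma contDiff_comp_fract {φ : ℝ → ℝ} (hφ : ContDiff ℝ ∞ φ) (hs : tsupport φ ⊆ Ioo (0 : ℝ) 1) :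
    ContDiff ℝ ∞ (fun x => φ (Int.fract x)) := by
  have hz : ∀ x, x ∉ Ioo (0 : ℝ) 1 → φ x = 0 := fun x hx => by
    by_contra h
    exact hx (hs (subset_tsupport φ h))
  rw [contDiff_iff_contDiffAt]
  intro x
  set n : ℤ := ⌊x⌋ with hn
  -- On `(n - 1, n + 1)` the periodic extension is the sum of two translates of `φ`.
  have hsum : ContDiff ℝ ∞ (fun y => φ (y - n) + φ (y - n + 1)) := by fun_prop
  refine hsum.contDiffAt.congr_of_eventuallyEq ?_
  have hmem : Ioo ((n : ℝ) - 1) (n + 1) ∈ 𝓝 x :=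
    Ioo_mem_nhds (by have := Int.floor_le x; linarith) (Int.lt_floor_add_one x)
  filter_upwards [hmem] with y hy
  rcases le_or_gt (n : ℝ) y with hny | hny
  · have : ⌊y⌋ = n := Int.floor_eq_iff.2 ⟨hny, hy.2⟩
    rw [hz (y - n + 1) (fun h => by linarith [h.2]), add_zero, Int.fract, this]
  · have : ⌊y⌋ = n - 1 := Int.floor_eq_iff.2 ⟨by push_cast; exact hy.1.le, by push_cast; linarith⟩
    rw [hz (y - n) (fun h => by linarith [h.1]), zero_add, Int.fract, this]
    push_cast
    congr 1
    ring

instance : IsProbabilityMeasure unitMeasure := ⟨by simp⟩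

lemma L2.integrable (u : L2) : Integrable u unitMeasure :=
  (Lp.memLp u).integrable (by norm_num)

lemma L2.integral_abs_le_norm (u : L2) : ∫ x in Ioo (0 : ℝ) 1, |u x| ≤ ‖u‖ := by
  have h := eLpNorm_le_eLpNorm_of_exponent_le (p := 1) (q := 2) (by norm_num)
    (Lp.aestronglyMeasurable u)
  have e : ∫ x in Ioo (0 : ℝ) 1, |u x| = (eLpNorm u 1 unitMeasure).toReal := by
    rw [eLpNorm_one_eq_lintegral_enorm]
    exact integral_norm_eq_lintegral_enorm (Lp.aestronglyMeasurable u)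
  rw [Lp.norm_def, e]
  exact ENNReal.toReal_mono (Lp.eLpNorm_ne_top u) h

/-- Test functions compactly supported in `(0,1)` may be used in place of periodic ones. -/
lemma IsPeriodicWeakDeriv.integral_mul_deriv {u g : L2} (h : IsPeriodicWeakDeriv u g) {φ : ℝ → ℝ}
    (hφ : ContDiff ℝ ∞ φ) (hs : tsupport φ ⊆ Ioo (0 : ℝ) 1) :
    ∫ x in Ioo (0 : ℝ) 1, u x * deriv φ x = -∫ x in Ioo (0 : ℝ) 1, g x * φ x := by
  have h1 := h _ (contDiff_comp_fract hφ hs) (fun x => by simp only [Int.fract_add_one])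
  have hfr : ∀ x ∈ Ioo (0 : ℝ) 1, Int.fract x = x := fun x hx =>
    Int.fract_eq_self.2 ⟨hx.1.le, hx.2⟩
  have e1 : ∫ x in Ioo (0 : ℝ) 1, u x * deriv φ x =
      ∫ x in Ioo (0 : ℝ) 1, u x * deriv (fun x => φ (Int.fract x)) x := by
    refine setIntegral_congr_fun measurableSet_Ioo fun x hx => ?_
    have : deriv (fun x => φ (Int.fract x)) x = deriv φ x := by
      refine Filter.EventuallyEq.deriv_eq ?_
      filter_upwards [isOpen_Ioo.mem_nhds hx] with y hy
      rw [hfr y hy]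
    simp only [this]
  have e2 : ∫ x in Ioo (0 : ℝ) 1, g x * φ (Int.fract x) = ∫ x in Ioo (0 : ℝ) 1, g x * φ x := by
    refine setIntegral_congr_fun measurableSet_Ioo fun x hx => ?_
    simp only [hfr x hx]
  rw [e1, h1, e2]

lemma IsPeriodicWeakDeriv.integral_eq_zero {u g : L2} (h : IsPeriodicWeakDeriv u g) :
    ∫ x in Ioo (0 : ℝ) 1, g x = 0 := by
  have h1 := h (fun _ => 1) contDiff_const (fun _ => rfl)
  simpa using h1

/-- A function in `H1per` has an absolutely continuous representative with equal boundary values,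
which is bounded by `‖u‖ + ‖u_x‖`. -/
lemma IsPeriodicWeakDeriv.exists_representative {u g : L2} (h : IsPeriodicWeakDeriv u g) :
    ∃ U : ℝ → ℝ, AbsolutelyContinuousOnInterval U 0 1 ∧
      (∀ᵐ x, x ∈ uIcc (0 : ℝ) 1 → HasDerivAt U (g x) x) ∧ U 1 = U 0 ∧
      u =ᵐ[unitMeasure] U ∧ ∀ x ∈ Ioo (0 : ℝ) 1, |U x| ≤ ‖u‖ + ‖g‖ := by
  obtain ⟨c, hc⟩ := ae_eq_const_add_integral_of_weakDeriv zero_lt_one (L2.integrable u)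
    (L2.integrable g) (fun φ hφ _ hs => h.integral_mul_deriv hφ hs)
  have hgi : IntervalIntegrable g volume 0 1 :=
    (intervalIntegrable_iff_integrableOn_Ioo_of_le zero_le_one).2 (L2.integrable g)
  refine ⟨fun x => c + ∫ t in (0 : ℝ)..x, g t,
    absolutelyContinuousOnInterval_const_add_integral c hgi,
    ae_hasDerivAt_const_add_integral c hgi, ?_, hc, ?_⟩
  · simp only [intervalIntegral.integral_same]
    rw [intervalIntegral.integral_of_le zero_le_one, integral_Ioc_eq_integral_Ioo,
      h.integral_eq_zero]
  · intro x hx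
    -- Average the bound `|U x| ≤ |u z| + ‖g‖` over `z`.
    have hb : ∀ᵐ z ∂unitMeasure, |c + ∫ t in (0 : ℝ)..x, g t| ≤ |u z| + ‖g‖ := by
      filter_upwards [hc, ae_restrict_mem measurableSet_Ioo] with z hz hzm
      have hsub : ∀ w ∈ Ioo (0 : ℝ) 1, IntervalIntegrable g volume 0 w := fun w hw =>
        hgi.mono_set (by rw [uIcc_of_le hw.1.le, uIcc_of_le zero_le_one]
                         exact Icc_subset_Icc_right hw.2.le)
      have e : c + ∫ t in (0 : ℝ)..x, g t = u z + ∫ t in z..x, g t := by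
        rw [hz, ← intervalIntegral.integral_add_adjacent_intervals (hsub z hzm)
          ((hsub z hzm).symm.trans (hsub x hx))]
        ring
      rw [e]
      refine (abs_add_le _ _).trans (add_le_add_right ?_ _)
      calc |∫ t in z..x, g t| ≤ ∫ t in uIoc z x, |g t| :=
            by
            simpa only [Real.norm_eq_abs] using
              intervalIntegral.norm_integral_le_integral_norm_uIoc (f := g) (a := z) (b := x)
        _ ≤ ∫ t in Ioo (0 : ℝ) 1, |g t| := by
            refine setIntegral_mono_set (L2.integrable g).abs (.of_forall fun _ => abs_nonneg _) ?_
            refine LE.le.eventuallyLE ?_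
            intro t ht
            rw [mem_uIoc] at ht
            rcases ht with ht | ht
            · exact ⟨hzm.1.trans ht.1, ht.2.trans_lt hx.2⟩
            · exact ⟨hx.1.trans ht.1, ht.2.trans_lt hzm.2⟩
        _ ≤ ‖g‖ := L2.integral_abs_le_norm g
    have hint := integral_mono_ae (integrable_const _)
      ((L2.integrable u).abs.add (integrable_const ‖g‖)) hb
    simp only [Pi.add_apply] at hint
    rw [integral_add (L2.integrable u).abs (integrable_const _)] at hint
    simp only [integral_const, probReal_univ, one_smul] at hint
    linarith [L2.integral_abs_le_norm u]

/-- The converse of `IsPeriodicWeakDeriv.exists_representative`. -/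
lemma isPeriodicWeakDeriv_of_representative {u g : L2} {U : ℝ → ℝ}
    (hU : AbsolutelyContinuousOnInterval U 0 1)
    (hd : ∀ᵐ x, x ∈ uIcc (0 : ℝ) 1 → HasDerivAt U (g x) x) (hper : U 1 = U 0)
    (hu : u =ᵐ[unitMeasure] U) : IsPeriodicWeakDeriv u g := by
  intro φ hφ hφp
  have h := hU.integral_mul_deriv_of_ae_hasDerivAt hd hφ
  have hφ1 : φ 1 = φ 0 := by simpa using hφp 0
  rw [hper, hφ1, sub_self, zero_sub, intervalIntegral.integral_of_le zero_le_one,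
    intervalIntegral.integral_of_le zero_le_one, integral_Ioc_eq_integral_Ioo,
    integral_Ioc_eq_integral_Ioo] at h
  rw [← h]
  refine integral_congr_ae ?_
  filter_upwards [hu] with x hx
  rw [hx]

lemma H1per.isPeriodicWeakDeriv (u : H1per) : IsPeriodicWeakDeriv (toL2 u) (dx u) := u.2

/-- The embedding of `H1per` into `L^∞`. -/
lemma H1per.ae_abs_le (u : H1per) :
    ∀ᵐ x ∂unitMeasure, |toL2 u x| ≤ ‖toL2 u‖ + ‖dx u‖ := by
  obtain ⟨U, -, -, -, hU, hb⟩ := (H1per.isPeriodicWeakDeriv u).exists_representative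
  filter_upwards [hU, ae_restrict_mem measurableSet_Ioo] with x hx hxm
  rw [hx]
  exact hb x hxm

lemma H1per.norm_toL2_le (u : H1per) : ‖toL2 u‖ ≤ ‖u‖ := WithLp.norm_fst_le _ u.1
lemma H1per.norm_dx_le (u : H1per) : ‖dx u‖ ≤ ‖u‖ := WithLp.norm_snd_le _ u.1

lemma H1per.continuous_iff {X : Type*} [TopologicalSpace X] {f : X → H1per} :
    Continuous f ↔ Continuous (fun x => toL2 (f x)) ∧ Continuous fun x => dx (f x) := by
  refine ⟨fun h => ⟨toL2.continuous.comp h, dx.continuous.comp h⟩, fun h => ?_⟩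
  refine Continuous.subtype_mk (f := fun x => (f x).1) ?_ _
  exact (WithLp.prod_continuous_toLp 2 L2 L2).comp (h.1.prodMk h.2)

/-! ### A smooth convex truncation -/

/-- The slope function `s ↦ min ((s - k)⁺) 1`. -/
def ramp (k s : ℝ) : ℝ := max 0 (min (s - k) 1)

/-- The `C^{1,1}` truncation at level `k`, a regularisation of `s ↦ (s - k)⁺`. -/
noncomputable def truncation (k s : ℝ) : ℝ := ∫ r in (0 : ℝ)..s, ramp k r

/-- The convex entropy at level `k`: the primitive of `truncation k`. -/
noncomputable def entropy (k s : ℝ) : ℝ := ∫ r in (0 : ℝ)..s, truncation k r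

lemma continuous_ramp (k : ℝ) : Continuous (ramp k) := by unfold ramp; fun_prop

lemma ramp_nonneg (k s : ℝ) : 0 ≤ ramp k s := le_max_left _ _

lemma ramp_le_one (k s : ℝ) : ramp k s ≤ 1 := max_le zero_le_one (min_le_right _ _)

lemma abs_ramp_le_one (k s : ℝ) : |ramp k s| ≤ 1 := by
  rw [abs_of_nonneg (ramp_nonneg k s)]; exact ramp_le_one k s

lemma monotone_ramp (k : ℝ) : Monotone (ramp k) := fun s t h =>
  max_le_max le_rfl (min_le_min (by linarith) le_rfl)

lemma abs_ramp_sub_le (k s t : ℝ) : |ramp k s - ramp k t| ≤ |s - t| := by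
  unfold ramp
  refine (abs_max_sub_max_le_max _ _ _ _).trans ?_
  refine max_le (by simp) ((abs_min_sub_min_le_max _ _ _ _).trans ?_)
  exact max_le (by simp) (by simp)

lemma ramp_eq_zero {k s : ℝ} (h : s ≤ k) : ramp k s = 0 :=
  max_eq_left ((min_le_left _ _).trans (by linarith))

lemma hasDerivAt_truncation (k s : ℝ) : HasDerivAt (truncation k) (ramp k s) s :=
  intervalIntegral.integral_hasDerivAt_right ((continuous_ramp k).intervalIntegrable _ _)
    (continuous_ramp k).aestronglyMeasurable.stronglyMeasurableAtFilter
    (continuous_ramp k).continuousAt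

lemma continuous_truncation (k : ℝ) : Continuous (truncation k) :=
  continuous_iff_continuousAt.2 fun s => (hasDerivAt_truncation k s).continuousAt

lemma truncation_zero (k : ℝ) : truncation k 0 = 0 := by simp [truncation]

lemma monotone_truncation (k : ℝ) : Monotone (truncation k) :=
  monotone_of_hasDerivAt_nonneg (fun s => hasDerivAt_truncation k s) fun s => ramp_nonneg k s

lemma lipschitzWith_truncation (k : ℝ) : LipschitzWith 1 (truncation k) :=
  lipschitzWith_of_nnnorm_deriv_le (fun s => (hasDerivAt_truncation k s).differentiableAt)
    fun s => by
      rw [(hasDerivAt_truncation k s).deriv, ← NNReal.coe_le_coe, coe_nnnorm, Real.norm_eq_abs]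
      exact abs_ramp_le_one k s

lemma abs_truncation_le (k s : ℝ) : |truncation k s| ≤ |s| := by
  simpa [truncation_zero] using (lipschitzWith_truncation k).dist_le_mul s 0

lemma hasDerivAt_entropy (k s : ℝ) : HasDerivAt (entropy k) (truncation k s) s :=
  intervalIntegral.integral_hasDerivAt_right ((continuous_truncation k).intervalIntegrable _ _)
    (continuous_truncation k).aestronglyMeasurable.stronglyMeasurableAtFilter
    (continuous_truncation k).continuousAt

lemma continuous_entropy (k : ℝ) : Continuous (entropy k) :=
  continuous_iff_continuousAt.2 fun s => (hasDerivAt_entropy k s).continuousAt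

lemma entropy_zero (k : ℝ) : entropy k 0 = 0 := by simp [entropy]

/-- The tangent line inequality for the convex function `entropy k`. -/
lemma entropy_sub_le (k a b : ℝ) : entropy k b - entropy k a ≤ truncation k b * (b - a) := by
  have h : entropy k b - entropy k a = ∫ r in a..b, truncation k r :=
    intervalIntegral.integral_interval_sub_left
      ((continuous_truncation k).intervalIntegrable _ _)
      ((continuous_truncation k).intervalIntegrable _ _)
  have hi : ∀ x y : ℝ, IntervalIntegrable (truncation k) volume x y := fun x y =>
    (continuous_truncation k).intervalIntegrable _ _
  rw [h]
  rcases le_total a b with hab | hab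
  · calc ∫ r in a..b, truncation k r ≤ ∫ _ in a..b, truncation k b :=
          intervalIntegral.integral_mono_on hab (hi _ _) (by simp) fun x hx =>
            monotone_truncation k hx.2
      _ = _ := by simp; ring
  · rw [intervalIntegral.integral_symm]
    have : ∫ _ in b..a, truncation k b ≤ ∫ r in b..a, truncation k r :=
      intervalIntegral.integral_mono_on hab (by simp) (hi _ _) fun x hx =>
        monotone_truncation k hx.1
    simp only [intervalIntegral.integral_const, smul_eq_mul] at this
    linarith

lemma entropy_nonneg (k s : ℝ) : 0 ≤ entropy k s := by
  have h := entropy_sub_le k s 0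
  rw [truncation_zero, entropy_zero] at h
  linarith

lemma entropy_le_sq (k s : ℝ) : entropy k s ≤ s ^ 2 := by
  have h := entropy_sub_le k 0 s
  rw [entropy_zero, sub_zero, sub_zero] at h
  refine h.trans ((le_abs_self _).trans ?_)
  rw [abs_mul, ← sq_abs, sq]
  exact mul_le_mul_of_nonneg_right (abs_truncation_le k s) (abs_nonneg s)

lemma abs_entropy_sub_le (k a b : ℝ) :
    |entropy k b - entropy k a| ≤ (|a| + |b|) * |b - a| := by
  have h1 : ∀ a b : ℝ, entropy k b - entropy k a ≤ (|a| + |b|) * |b - a| := fun a b => by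
    refine (entropy_sub_le k a b).trans ((le_abs_self _).trans ?_)
    rw [abs_mul]
    refine mul_le_mul_of_nonneg_right ?_ (abs_nonneg _)
    linarith [abs_truncation_le k b, abs_nonneg a]
  rw [abs_sub_le_iff]
  refine ⟨h1 a b, (h1 b a).trans_eq ?_⟩
  rw [abs_sub_comm, add_comm]

section Level

variable {k : ℝ}

lemma truncation_eq_zero (hk : 0 ≤ k) {s : ℝ} (h : s ≤ k) : truncation k s = 0 := by
  refine (intervalIntegral.integral_congr (g := fun _ => 0) fun r hr => ?_).trans (by simp)
  exact ramp_eq_zero ((mem_uIcc.1 hr).elim (fun h' => h'.2.trans h) fun h' => h'.2.trans hk)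

lemma truncation_nonneg (hk : 0 ≤ k) (s : ℝ) : 0 ≤ truncation k s := by
  rcases le_total s k with h | h
  · exact (truncation_eq_zero hk h).ge
  · exact (truncation_eq_zero hk le_rfl).ge.trans (monotone_truncation k h)

lemma entropy_eq_zero (hk : 0 ≤ k) {s : ℝ} (h : s ≤ k) : entropy k s = 0 := by
  refine (intervalIntegral.integral_congr (g := fun _ => 0) fun r hr => ?_).trans (by simp)
  exact truncation_eq_zero hk
    ((mem_uIcc.1 hr).elim (fun h' => h'.2.trans h) fun h' => h'.2.trans hk)

/-- Since the derivative of `truncation²` is `2 truncation · ramp` and `ramp` is monotone,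
integration gives `truncation² ≤ 2 ramp · entropy`. This is what lets the diffusion absorb the
transport term. -/
lemma truncation_sq_le (hk : 0 ≤ k) (s : ℝ) :
    truncation k s ^ 2 ≤ 2 * ramp k s * entropy k s := by
  rcases le_total s 0 with hs | hs
  · rw [truncation_eq_zero hk (hs.trans hk)]
    have := mul_nonneg (ramp_nonneg k s) (entropy_nonneg k s)
    nlinarith
  · have hd : ∀ r ∈ uIcc 0 s,
        HasDerivAt (fun r => truncation k r ^ 2) (2 * truncation k r * ramp k r) r := fun r _ => by
      simpa using (hasDerivAt_truncation k r).fun_pow 2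
    have hc : Continuous fun r => 2 * truncation k r * ramp k r :=
      (continuous_const.mul (continuous_truncation k)).mul (continuous_ramp k)
    have h := intervalIntegral.integral_eq_sub_of_hasDerivAt hd (hc.intervalIntegrable _ _)
    simp only [truncation_zero] at h
    rw [zero_pow two_ne_zero, sub_zero] at h
    rw [← h]
    calc ∫ r in (0 : ℝ)..s, 2 * truncation k r * ramp k r
        ≤ ∫ r in (0 : ℝ)..s, 2 * ramp k s * truncation k r := by
          refine intervalIntegral.integral_mono_on hs (hc.intervalIntegrable _ _)
            ((continuous_const.mul (continuous_truncation k)).intervalIntegrable _ _) ?_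
          intro r hr
          have h1 := monotone_ramp k hr.2
          have h2 := truncation_nonneg hk r
          nlinarith
      _ = 2 * ramp k s * entropy k s := by
          rw [intervalIntegral.integral_const_mul]; rfl

lemma le_of_entropy_eq_zero (hk : 0 ≤ k) {s : ℝ} (h : entropy k s = 0) : s ≤ k := by
  by_contra! hs
  have h1 : truncation k s ^ 2 ≤ 0 := by simpa [h] using truncation_sq_le hk s
  have h2 : truncation k s - truncation k k = ∫ r in k..s, ramp k r :=
    intervalIntegral.integral_interval_sub_left
      ((continuous_ramp k).intervalIntegrable _ _) ((continuous_ramp k).intervalIntegrable _ _)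
  have h3 : 0 < ∫ r in k..s, ramp k r :=
    intervalIntegral.intervalIntegral_pos_of_pos_on ((continuous_ramp k).intervalIntegrable _ _)
      (fun r hr => lt_max_of_lt_right (lt_min (by linarith [hr.1]) one_pos)) hs
  rw [truncation_eq_zero hk le_rfl] at h2
  nlinarith

/-- The pointwise form of the energy estimate: the dissipation `-γ p²` absorbs the transport
term up to a multiple of the entropy. -/
lemma neg_dissipation_add_transport_le (hk : 0 ≤ k) {α A p s : ℝ} (hα : |α| ≤ A) :
    -(p * (ramp k s * p)) + α * p * truncation k s ≤ A ^ 2 / 2 * entropy k s := by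
  have h1 := truncation_sq_le hk s
  have h2 := ramp_nonneg k s
  have h3 := entropy_nonneg k s
  have hA : α ^ 2 ≤ A ^ 2 := sq_le_sq' (by linarith [abs_le.1 hα]) (abs_le.1 hα).2
  have h4 : α ^ 2 * entropy k s ≤ A ^ 2 * entropy k s := mul_le_mul_of_nonneg_right hA h3
  rcases h2.eq_or_lt with h0 | h0
  · rw [← h0] at h1 ⊢
    have : truncation k s = 0 := by nlinarith
    rw [this]
    nlinarith
  · have h5 : ramp k s * (α * p * truncation k s) ≤
        ramp k s * (ramp k s * p ^ 2 + α ^ 2 * entropy k s / 2) := by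
      nlinarith [sq_nonneg (2 * ramp k s * p - α * truncation k s),
        mul_le_mul_of_nonneg_left h1 (sq_nonneg α)]
    have h6 := le_of_mul_le_mul_left h5 h0
    nlinarith

end Level

/-! ### Truncation of functions in `H1per` -/

/-- The weak derivative `γ(u) u_x` of the truncation of `u`, with `γ = ramp k`. -/
noncomputable def rampMul (k : ℝ) (u g : L2) : L2 :=
  MemLp.toLp (fun x => ramp k (u x) * g x) <| (Lp.memLp g).of_le
    (((continuous_ramp k).comp_aestronglyMeasurable (Lp.aestronglyMeasurable u)).mul
      (Lp.aestronglyMeasurable g))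
    (.of_forall fun x => by
      rw [norm_mul, Real.norm_eq_abs]
      exact mul_le_of_le_one_left (norm_nonneg _) (abs_ramp_le_one k _))

lemma coeFn_rampMul (k : ℝ) (u g : L2) :
    rampMul k u g =ᵐ[unitMeasure] fun x => ramp k (u x) * g x := MemLp.coeFn_toLp _

lemma norm_rampMul_le (k : ℝ) (u g : L2) : ‖rampMul k u g‖ ≤ ‖g‖ := by
  refine Lp.norm_le_norm_of_ae_le ?_
  filter_upwards [coeFn_rampMul k u g] with x hx
  rw [hx, norm_mul, Real.norm_eq_abs]
  exact mul_le_of_le_one_left (norm_nonneg _) (abs_ramp_le_one k _)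

/-- The truncation of an element of `L2`. -/
noncomputable def truncL2 (k : ℝ) (u : L2) : L2 :=
  (lipschitzWith_truncation k).compLp (truncation_zero k) u

lemma coeFn_truncL2 (k : ℝ) (u : L2) :
    truncL2 k u =ᵐ[unitMeasure] fun x => truncation k (u x) :=
  (lipschitzWith_truncation k).coeFn_compLp (truncation_zero k) u

lemma norm_truncL2_le (k : ℝ) (u : L2) : ‖truncL2 k u‖ ≤ ‖u‖ := by
  simpa [truncL2] using (lipschitzWith_truncation k).norm_compLp_le (truncation_zero k) u

/-- The chain rule for the truncation. -/
lemma IsPeriodicWeakDeriv.truncL2 {u g : L2} (h : IsPeriodicWeakDeriv u g) (k : ℝ) :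
    IsPeriodicWeakDeriv (truncL2 k u) (rampMul k u g) := by
  obtain ⟨U, hU, hd, hper, hu, -⟩ := h.exists_representative
  refine isPeriodicWeakDeriv_of_representative (U := fun x => truncation k (U x))
    ((lipschitzWith_truncation k).comp_absolutelyContinuousOnInterval hU) ?_ (by simp [hper]) ?_
  · have h1 : ∀ᵐ x, x ∈ Ioo (0 : ℝ) 1 → rampMul k u g x = ramp k (U x) * g x := by
      rw [← ae_restrict_iff' measurableSet_Ioo]
      filter_upwards [coeFn_rampMul k u g, hu] with x hx hxu
      rw [hx, hxu]
    have h0 : ∀ᵐ x : ℝ, x ≠ 0 := by simp [ae_iff]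
    have h1' : ∀ᵐ x : ℝ, x ≠ 1 := by simp [ae_iff]
    filter_upwards [h1, hd, h0, h1'] with x hx hdx hx0 hx1 hxm
    have hxm' := hxm
    rw [uIcc_of_le zero_le_one] at hxm'
    rw [hx ⟨lt_of_le_of_ne hxm'.1 hx0.symm, lt_of_le_of_ne hxm'.2 hx1⟩]
    exact (hasDerivAt_truncation k (U x)).comp x (hdx hxm)
  · filter_upwards [coeFn_truncL2 k u, hu] with x hx hxu
    rw [hx, hxu]

/-- The truncation `u ↦ truncation k (u)` as a nonlinear map of `H1per` into itself. -/
noncomputable def H1per.trunc (k : ℝ) (u : H1per) : H1per :=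
  ⟨WithLp.toLp 2 (truncL2 k (toL2 u), rampMul k (toL2 u) (dx u)),
    (H1per.isPeriodicWeakDeriv u).truncL2 k⟩

lemma H1per.toL2_trunc (k : ℝ) (u : H1per) : toL2 (trunc k u) = truncL2 k (toL2 u) := rfl

lemma H1per.dx_trunc (k : ℝ) (u : H1per) : dx (trunc k u) = rampMul k (toL2 u) (dx u) := rfl

lemma H1per.norm_sq (u : H1per) : ‖u‖ ^ 2 = ‖toL2 u‖ ^ 2 + ‖dx u‖ ^ 2 :=
  WithLp.prod_norm_sq_eq_of_L2 u.1

lemma H1per.norm_trunc_le (k : ℝ) (u : H1per) : ‖trunc k u‖ ≤ ‖u‖ := by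
  refine le_of_sq_le_sq ?_ (norm_nonneg _)
  rw [H1per.norm_sq, H1per.norm_sq, H1per.toL2_trunc, H1per.dx_trunc]
  have h1 := norm_truncL2_le k (toL2 u)
  have h2 := norm_rampMul_le k (toL2 u) (dx u)
  gcongr

/-- The estimate behind the continuity of the truncation in `H1per`: as `ramp k` is Lipschitz and
`H1per` embeds in `L^∞`, the product `γ(u) u_x` depends continuously on `u`. -/
lemma H1per.norm_dx_trunc_sub_le (k : ℝ) (v u : H1per) :
    ‖dx (trunc k v) - dx (trunc k u)‖ ≤ (1 + 2 * ‖dx u‖) * ‖v - u‖ := by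
  rw [H1per.dx_trunc, H1per.dx_trunc]
  set δ : ℝ := ‖toL2 (v - u)‖ + ‖dx (v - u)‖ with hδ
  have hδ0 : 0 ≤ δ := by positivity
  have h : ‖rampMul k (toL2 v) (dx v) - rampMul k (toL2 u) (dx u)‖ ≤
      ‖|dx (v - u)| + δ • |dx u|‖ := by
    refine Lp.norm_le_norm_of_ae_le ?_
    filter_upwards [coeFn_rampMul k (toL2 v) (dx v), coeFn_rampMul k (toL2 u) (dx u),
      Lp.coeFn_sub (rampMul k (toL2 v) (dx v)) (rampMul k (toL2 u) (dx u)),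
      Lp.coeFn_add |dx (v - u)| (δ • |dx u|), Lp.coeFn_smul δ |dx u|,
      Lp.coeFn_abs (dx (v - u)), Lp.coeFn_abs (dx u), H1per.ae_abs_le (v - u),
      Lp.coeFn_sub (toL2 v) (toL2 u), Lp.coeFn_sub (dx v) (dx u)]
      with x h1 h2 h3 h4 h5 h6 h7 h8 h9 h10
    replace h8 : |toL2 (v - u) x| ≤ δ := h8
    rw [map_sub, h9, Pi.sub_apply] at h8
    rw [map_sub] at h6
    rw [h3, h4, Pi.sub_apply, Pi.add_apply, h1, h2, h5, Pi.smul_apply, map_sub, h6, h7]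
    rw [h10, Pi.sub_apply, smul_eq_mul]
    have hs : |ramp k (toL2 v x) - ramp k (toL2 u x)| ≤ δ := (abs_ramp_sub_le k _ _).trans h8
    have e : ramp k (toL2 v x) * dx v x - ramp k (toL2 u x) * dx u x =
        ramp k (toL2 v x) * (dx v x - dx u x) +
          (ramp k (toL2 v x) - ramp k (toL2 u x)) * dx u x := by ring
    rw [Real.norm_eq_abs, Real.norm_eq_abs, e]
    refine le_trans ?_ (le_abs_self _)
    refine (abs_add_le _ _).trans ?_
    rw [abs_mul, abs_mul]
    exact add_le_add (mul_le_of_le_one_left (abs_nonneg _) (abs_ramp_le_one k _))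
      (mul_le_mul_of_nonneg_right hs (abs_nonneg _))
  refine h.trans ((norm_add_le _ _).trans ?_)
  rw [norm_smul, norm_abs_eq_norm, norm_abs_eq_norm, Real.norm_of_nonneg hδ0]
  have h1 := H1per.norm_toL2_le (v - u)
  have h2 := H1per.norm_dx_le (v - u)
  have h3 : δ * ‖dx u‖ ≤ (2 * ‖v - u‖) * ‖dx u‖ :=
    mul_le_mul_of_nonneg_right (by linarith) (norm_nonneg _)
  linarith

lemma H1per.continuous_trunc (k : ℝ) : Continuous (trunc k) := by
  rw [H1per.continuous_iff]
  refine ⟨((lipschitzWith_truncation k).continuous_compLp (truncation_zero k)).comp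
    toL2.continuous, ?_⟩
  rw [continuous_iff_continuousAt]
  intro u
  rw [ContinuousAt, tendsto_iff_norm_sub_tendsto_zero]
  have h : Tendsto (fun v : H1per => (1 + 2 * ‖dx u‖) * ‖v - u‖) (𝓝 u) (𝓝 0) := by
    have : Continuous fun v : H1per => (1 + 2 * ‖dx u‖) * ‖v - u‖ := by fun_prop
    simpa using this.tendsto u
  exact squeeze_zero (fun _ => norm_nonneg _) (fun v => H1per.norm_dx_trunc_sub_le k v u) h

/-! ### Difference quotients in time -/

/-- Extension by zero of a square integrable function. -/
lemma exists_memLp_two_extend {G : Type*} [NormedAddCommGroup G] {f : ℝ → G} {S : Set ℝ}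
    (hS : MeasurableSet S) (hf : MemLp f 2 (volume.restrict S)) :
    ∃ f' : ℝ → G, MemLp f' 2 volume ∧ (∀ t ∈ S, f' t = f t) ∧ ∀ t, t ∉ S → f' t = 0 :=
  ⟨S.indicator f, (memLp_indicator_iff_restrict hS).2 hf, fun _ h => indicator_of_mem h _,
    fun _ h => indicator_of_notMem h _⟩

section Pairing

variable {E : Type*} [NormedAddCommGroup E] [NormedSpace ℝ E] {D : ℝ → StrongDual ℝ E} {W : ℝ → E}

/-- Continuity of translations in `L²`, tested against a fixed `L²` function. -/
lemma continuous_integral_translate_pairing (hD : MemLp D 2 volume) (hW : MemLp W 2 volume) :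
    Continuous fun r : ℝ => ∫ t, D (t - r) (W t) := by
  let τ : ℝ → C(ℝ, ℝ) := fun r => ⟨fun t => t - r, by fun_prop⟩
  have hτ : Continuous τ := by
    let σ : C(ℝ × ℝ, ℝ) := ⟨fun p => p.2 - p.1, by fun_prop⟩
    exact σ.curry.continuous
  have hm : ∀ r, MeasurePreserving (τ r) (volume : Measure ℝ) volume := fun r =>
    measurePreserving_sub_right (volume : Measure ℝ) r
  have hc : Continuous fun r => Lp.compMeasurePreserving (τ r) (hm r) (hD.toLp D) :=
    (continuous_const (y := hD.toLp D)).compMeasurePreservingLp hτ hm ENNReal.ofNat_ne_top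
  let B := (ContinuousLinearMap.id ℝ (StrongDual ℝ E)).lpPairing (volume : Measure ℝ) 2 2
  have h1 : Continuous fun r => B (Lp.compMeasurePreserving (τ r) (hm r) (hD.toLp D))
      (hW.toLp W) := (B.continuous.comp hc).clm_apply continuous_const
  refine h1.congr fun r => ?_
  rw [ContinuousLinearMap.lpPairing_eq_integral]
  refine integral_congr_ae ?_
  have h2 := (hm r).quasiMeasurePreserving.ae_eq_comp hD.coeFn_toLp
  filter_upwards [Lp.coeFn_compMeasurePreserving (hD.toLp D) (hm r), h2, hW.coeFn_toLp]
    with t h3 h4 h5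
  rw [h3, h4, h5]
  rfl

lemma integrable_prod_translate_pairing (hD : MemLp D 2 volume) (hW : MemLp W 2 volume) (h : ℝ) :
    Integrable (fun p : ℝ × ℝ => (Ioc 0 h).indicator (fun _ => (1 : ℝ)) p.2 * D (p.1 - p.2) (W p.1))
      (volume.prod volume) := by
  have h1 : Integrable ((Ioc 0 h).indicator fun _ => (1 : ℝ)) volume :=
    (integrable_indicator_iff measurableSet_Ioc).2 (integrableOn_const (by simp))
  have hD2 : Integrable (fun t => ‖D t‖ ^ 2) volume := hD.norm.integrable_sq
  have hW2 : Integrable (fun t => ‖W t‖ ^ 2) volume := hW.norm.integrable_sq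
  have hA := h1.convolution_integrand (ContinuousLinearMap.mul ℝ ℝ) hD2
  have hB := hW2.mul_prod h1
  refine Integrable.mono' (hA.add hB) ?_ (.of_forall fun p => ?_)
  · have hm := h1.aestronglyMeasurable.convolution_integrand
      (ContinuousLinearMap.lsmul ℝ ℝ) hD.aestronglyMeasurable (μ := volume)
    have hW' : AEStronglyMeasurable (fun p : ℝ × ℝ => W p.1) (volume.prod volume) :=
      hW.aestronglyMeasurable.comp_fst
    have := (ContinuousLinearMap.id ℝ (StrongDual ℝ E)).aestronglyMeasurable_comp₂ hm hW'
    simpa using this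
  · simp only [Pi.add_apply, ContinuousLinearMap.mul_apply']
    by_cases hp : p.2 ∈ Ioc 0 h
    · rw [indicator_of_mem hp]
      have := (D (p.1 - p.2)).le_opNorm (W p.1)
      rw [one_mul, one_mul, mul_one]
      nlinarith [sq_nonneg (‖D (p.1 - p.2)‖ - ‖W p.1‖), sq_nonneg (‖D (p.1 - p.2)‖),
        sq_nonneg (‖W p.1‖)]
    · rw [indicator_of_notMem hp]
      simp

/-- If the backward increments of `F` are controlled by those of a primitive of `D`, paired with
`W` at the final time, then the total increment of `F` is controlled by the integral of the
pairing. This replaces the chain rule for `F`, whose differentiability is not known. -/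
lemma sub_le_integral_pairing (hD : MemLp D 2 volume) (hW : MemLp W 2 volume)
    {F : ℝ → ℝ} (hF : Continuous F) {s T δ : ℝ} (hsT : s ≤ T) (hδ : 0 < δ)
    (hW0 : ∀ t, t ∉ Ioc s T → W t = 0)
    (hinc : ∀ h ∈ Ioo 0 δ, ∀ᵐ t ∂(volume.restrict (Ioc s T)),
      F t - F (t - h) ≤ ∫ r in (0 : ℝ)..h, D (t - r) (W t)) :
    F T - F s ≤ ∫ t, D t (W t) := by
  set G : ℝ → ℝ := fun r => ∫ t, D (t - r) (W t) with hG
  have hGc : Continuous G := continuous_integral_translate_pairing hD hW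
  have hFi : ∀ x y, IntervalIntegrable F volume x y := fun x y => hF.intervalIntegrable x y
  have hprim : ∀ {f : ℝ → ℝ}, Continuous f → ∀ c x,
      HasDerivAt (fun x => ∫ t in c..x, f t) (f x) x := fun {f} hf c x =>
    intervalIntegral.integral_hasDerivAt_right (hf.intervalIntegrable _ _)
      hf.aestronglyMeasurable.stronglyMeasurableAtFilter hf.continuousAt
  -- Integrating the increments over `t` and exchanging the integrals.
  have hint : ∀ h ∈ Ioo 0 δ,
      (∫ t in (T - h)..T, F t) - ∫ t in (s - h)..s, F t ≤ ∫ r in (0 : ℝ)..h, G r := by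
    intro h hh
    have hFs : Continuous fun t => F (t - h) := hF.comp (continuous_id.sub continuous_const)
    have hP := integrable_prod_translate_pairing hD hW h
    have hin : ∀ t, ∫ r, (Ioc 0 h).indicator (fun _ => (1 : ℝ)) r * D (t - r) (W t) =
        ∫ r in (0 : ℝ)..h, D (t - r) (W t) := fun t => by
      rw [intervalIntegral.integral_of_le hh.1.le, ← integral_indicator measurableSet_Ioc]
      refine integral_congr_ae (.of_forall fun r => ?_)
      by_cases hr : r ∈ Ioc 0 h <;> simp [hr]
    have hout : ∫ r, ∫ t, (Ioc 0 h).indicator (fun _ => (1 : ℝ)) r * D (t - r) (W t) =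
        ∫ r in (0 : ℝ)..h, G r := by
      rw [intervalIntegral.integral_of_le hh.1.le, ← integral_indicator measurableSet_Ioc]
      refine integral_congr_ae (.of_forall fun r => ?_)
      simp only [integral_const_mul]
      by_cases hr : r ∈ Ioc 0 h <;> simp [hr, hG]
    have hswap := integral_integral_swap (f := fun t r =>
      (Ioc 0 h).indicator (fun _ => (1 : ℝ)) r * D (t - r) (W t)) hP
    simp only [hin] at hswap
    rw [hout] at hswap
    have hIi : Integrable (fun t => ∫ r in (0 : ℝ)..h, D (t - r) (W t)) := by
      have := hP.integral_prod_left
      simpa only [hin] using this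
    have hsupp : ∫ t, (∫ r in (0 : ℝ)..h, D (t - r) (W t)) =
        ∫ t in Ioc s T, ∫ r in (0 : ℝ)..h, D (t - r) (W t) := by
      refine (setIntegral_eq_integral_of_forall_compl_eq_zero fun t ht => ?_).symm
      simp [hW0 t ht]
    have hle : ∫ t in s..T, (F t - F (t - h)) ≤ ∫ r in (0 : ℝ)..h, G r := by
      rw [← hswap, hsupp, intervalIntegral.integral_of_le hsT]
      refine integral_mono_ae ?_ hIi.integrableOn (hinc h hh)
      exact (hF.sub hFs).integrableOn_Ioc
    refine le_of_eq_of_le ?_ hle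
    rw [intervalIntegral.integral_sub (hFi _ _)
      (hFs.intervalIntegrable _ _),
      intervalIntegral.integral_comp_sub_right]
    have e1 := intervalIntegral.integral_add_adjacent_intervals (hFi s (T - h)) (hFi (T - h) T)
    have e2 := intervalIntegral.integral_add_adjacent_intervals (hFi (s - h) s) (hFi s (T - h))
    linarith
  -- Dividing by `h` and letting `h → 0`.
  have hder : HasDerivAt (fun h => (∫ r in (0 : ℝ)..h, G r) -
      ((∫ t in (T - h)..T, F t) - ∫ t in (s - h)..s, F t)) (G 0 - (F T - F s)) 0 := by
    have hback : ∀ x, HasDerivAt (fun h => ∫ t in (x - h)..x, F t) (F x) 0 := fun x => by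
      have h1 : HasDerivAt (fun h : ℝ => x - h) (-1) 0 := by
        simpa using (hasDerivAt_id (0 : ℝ)).const_sub x
      have h2 : HasDerivAt (fun y => ∫ t in x..y, F t) (F (x - 0)) (x - 0) := hprim hF x (x - 0)
      have h3 := (HasDerivAt.comp (0 : ℝ) h2 h1).neg
      simp only [sub_zero, mul_neg, mul_one, neg_neg] at h3
      refine h3.congr_of_eventuallyEq (.of_forall fun h => ?_)
      simp only [Pi.neg_apply, Function.comp_apply]
      rw [intervalIntegral.integral_symm]
    exact (hprim hGc 0 0).sub ((hback T).sub (hback s))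
  have hlim := hder.tendsto_slope_zero_right
  have hnn : 0 ≤ G 0 - (F T - F s) := by
    refine ge_of_tendsto hlim ?_
    filter_upwards [Ioo_mem_nhdsGT hδ] with h hh
    have := hint h hh
    simp only [zero_add, sub_zero, intervalIntegral.integral_same, smul_eq_mul]
    exact mul_nonneg (inv_nonneg.2 hh.1.le) (by linarith)
  have hG0 : G 0 = ∫ t, D t (W t) := by simp [hG]
  linarith

/-- A version of `sub_le_integral_pairing` in which `D` and `W` are only given on bounded
intervals. -/
lemma sub_le_setIntegral_pairing {F : ℝ → ℝ} (hF : Continuous F) {s T δ : ℝ} (hsT : s ≤ T)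
    (hδ : 0 < δ) (hD : MemLp D 2 (volume.restrict (Icc (s - δ) T)))
    (hW : MemLp W 2 (volume.restrict (Ioc s T)))
    (hinc : ∀ h ∈ Ioo 0 δ, ∀ᵐ t ∂(volume.restrict (Ioc s T)),
      F t - F (t - h) ≤ ∫ r in (t - h)..t, D r (W t)) :
    IntegrableOn (fun t => D t (W t)) (Ioc s T) ∧ F T - F s ≤ ∫ t in Ioc s T, D t (W t) := by
  obtain ⟨D', hD', hDe, -⟩ := exists_memLp_two_extend measurableSet_Icc hD
  obtain ⟨W', hW', hWe, hW0⟩ := exists_memLp_two_extend measurableSet_Ioc hW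
  have hsub : Ioc s T ⊆ Icc (s - δ) T := fun t ht => ⟨by linarith [ht.1], ht.2⟩
  have hDs := hD.mono_measure (Measure.restrict_mono hsub le_rfl)
  refine ⟨?_, ?_⟩
  · refine Integrable.mono' (g := fun t => ‖D t‖ ^ 2 + ‖W t‖ ^ 2)
      (hDs.norm.integrable_sq.add hW.norm.integrable_sq)
      ((ContinuousLinearMap.id ℝ (StrongDual ℝ E)).aestronglyMeasurable_comp₂
        hDs.aestronglyMeasurable hW.aestronglyMeasurable) (.of_forall fun t => ?_)
    refine ((D t).le_opNorm (W t)).trans ?_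
    have := two_mul_le_add_sq ‖D t‖ ‖W t‖
    have := mul_nonneg (norm_nonneg (D t)) (norm_nonneg (W t))
    linarith
  · refine (sub_le_integral_pairing hD' hW' hF hsT hδ
      hW0 ?_).trans_eq ?_
    · intro h hh
      filter_upwards [hinc h hh, ae_restrict_mem measurableSet_Ioc] with t hi ht
      refine hi.trans_eq ?_
      have h3 := intervalIntegral.integral_comp_sub_left (a := 0) (b := h)
        (fun r => D r (W t)) t
      rw [sub_zero] at h3
      rw [← h3, hWe t ht]
      refine intervalIntegral.integral_congr fun r hr => ?_
      rw [uIcc_of_le hh.1.le] at hr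
      rw [hDe (t - r) ⟨by linarith [ht.1, hr.2, hh.2], by linarith [ht.2, hr.1]⟩]
    · rw [← setIntegral_eq_integral_of_forall_compl_eq_zero (s := Ioc s T)
        (fun t ht => by rw [hW0 t ht, map_zero])]
      refine setIntegral_congr_fun measurableSet_Ioc fun t ht => ?_
      simp only [hWe t ht, hDe t (hsub ht)]

/-- A continuous function with values in a dual space whose weak time derivative is locally square
integrable is, tested with a fixed vector, a primitive of that derivative. -/
lemma IsWeakTimeDeriv.sub_eq_integral {f : ℝ → StrongDual ℝ E}
    (hf : ContinuousOn f (Ici 0)) (hD : MemL2loc D)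
    (h : IsWeakTimeDeriv f D) {s t : ℝ} (hs : 0 < s) (hst : s ≤ t) (z : E) :
    f t z - f s z = ∫ r in s..t, D r z := by
  set a : ℝ := s / 2 with ha
  set b : ℝ := t + 1 with hb
  have ha0 : 0 < a := by positivity
  have hab : a < b := by linarith
  have hIcc : Icc a b ⊆ Ici 0 := fun r hr => ha0.le.trans hr.1
  have hIoo : Ioo a b ⊆ Ioi 0 := fun r hr => ha0.trans hr.1
  have hfc : ContinuousOn (fun r => f r z) (Icc a b) :=
    (ContinuousLinearMap.apply ℝ ℝ z).continuous.comp_continuousOn (hf.mono hIcc)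
  have hDi : IntegrableOn D (Icc a b) := (hD a b ha0 hab).integrable (by norm_num)
  have hgi : IntegrableOn (fun r => D r z) (Icc a b) :=
    (ContinuousLinearMap.apply ℝ ℝ z).integrable_comp hDi
  have hweak : ∀ φ : ℝ → ℝ, ContDiff ℝ ∞ φ → HasCompactSupport φ → tsupport φ ⊆ Ioo a b →
      ∫ r in Ioo a b, f r z * deriv φ r =
        -∫ r in Ioo a b, D r z * φ r := by
    intro φ hφ hc hsφ
    have h0 : ∀ r, r ∉ Ioo a b → φ r = 0 := fun r hr => by
      by_contra h
      exact hr (hsφ (subset_tsupport φ h))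
    have h0' : ∀ r, r ∉ Ioo a b → deriv φ r = 0 := fun r hr => by
      by_contra h
      exact hr (hsφ (support_deriv_subset h))
    have h1 := h φ hφ hc (hsφ.trans hIoo)
    rw [setIntegral_eq_of_subset_of_forall_sdiff_eq_zero measurableSet_Ioi hIoo
        (fun r hr => by rw [h0' r hr.2, zero_smul]),
      setIntegral_eq_of_subset_of_forall_sdiff_eq_zero measurableSet_Ioi hIoo
        (fun r hr => by rw [h0 r hr.2, zero_smul])] at h1
    have hcd : Continuous (deriv φ) := hφ.continuous_deriv (by simp)
    have i1 : IntegrableOn (fun r => deriv φ r • f r) (Ioo a b) :=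
      (ContinuousOn.integrableOn_compact isCompact_Icc (hcd.continuousOn.smul
        (hf.mono hIcc))).mono_set Ioo_subset_Icc_self
    have i2 : IntegrableOn (fun r => φ r • D r) (Ioo a b) := by
      obtain ⟨C, hC⟩ := hφ.continuous.bounded_above_of_compact_support hc
      exact (hDi.mono_set Ioo_subset_Icc_self).bdd_smul C
        hφ.continuous.aestronglyMeasurable (.of_forall hC)
    have h2 := congrArg (fun L : StrongDual ℝ E => L z) h1
    simp only [neg_apply] at h2
    rw [ContinuousLinearMap.integral_apply i1, ContinuousLinearMap.integral_apply i2] at h2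
    simp only [smul_apply, smul_eq_mul] at h2
    simp only [mul_comm _ (deriv φ _), mul_comm _ (φ _)]
    exact h2
  obtain ⟨c, hc⟩ := ae_eq_const_add_integral_of_weakDeriv hab
    (hfc.integrableOn_compact isCompact_Icc |>.mono_set Ioo_subset_Icc_self)
    (hgi.mono_set Ioo_subset_Icc_self) hweak
  have hgii : IntervalIntegrable (fun r => D r z) volume a b :=
    (intervalIntegrable_iff_integrableOn_Icc_of_le hab.le).2 hgi
  have hV : ContinuousOn (fun x => c + ∫ r in a..x, D r z) (Icc a b) := by
    have := (absolutelyContinuousOnInterval_const_add_integral c hgii).continuousOn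
    rwa [uIcc_of_le hab.le] at this
  have heq := Measure.eqOn_open_of_ae_eq hc isOpen_Ioo (hfc.mono Ioo_subset_Icc_self)
    (hV.mono Ioo_subset_Icc_self)
  have hsm : s ∈ Ioo a b := ⟨by linarith, by linarith⟩
  have htm : t ∈ Ioo a b := ⟨by linarith, by linarith⟩
  have hsub : ∀ x ∈ Ioo a b, IntervalIntegrable (fun r => D r z) volume a x := fun x hx =>
    hgii.mono_set (by
      rw [uIcc_of_le hx.1.le, uIcc_of_le hab.le]
      exact Icc_subset_Icc_right hx.2.le)
  have e1 := heq hsm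
  have e2 := heq htm
  simp only at e1 e2
  rw [e1, e2, ← intervalIntegral.integral_interval_sub_left (hsub t htm) (hsub s hsm)]
  ring

end Pairing

/-! ### The entropy functional on `L2` -/

/-- The integral of the convex entropy. -/
noncomputable def entropyInt (k : ℝ) (u : L2) : ℝ := ∫ x in Ioo (0 : ℝ) 1, entropy k (u x)

lemma integrable_entropy (k : ℝ) (u : L2) : Integrable (fun x => entropy k (u x)) unitMeasure := by
  refine (Lp.memLp u).integrable_sq.mono'
    ((continuous_entropy k).comp_aestronglyMeasurable (Lp.aestronglyMeasurable u))
    (.of_forall fun x => ?_)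
  rw [Real.norm_of_nonneg (entropy_nonneg k _)]
  exact entropy_le_sq k _

lemma entropyInt_nonneg (k : ℝ) (u : L2) : 0 ≤ entropyInt k u :=
  integral_nonneg fun _ => entropy_nonneg k _

lemma L2.inner_eq (u v : L2) : inner ℝ u v = ∫ x in Ioo (0 : ℝ) 1, u x * v x := by
  rw [L2.inner_def]
  refine integral_congr_ae (.of_forall fun x => ?_)
  simp [mul_comm]

lemma L2.integrable_mul (u v : L2) : Integrable (fun x => u x * v x) unitMeasure :=
  (Lp.memLp u).integrable_mul (Lp.memLp v)

/-- The tangent line inequality for the entropy functional. -/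
lemma entropyInt_sub_le (k : ℝ) (u v : L2) :
    entropyInt k v - entropyInt k u ≤ inner ℝ (v - u) (truncL2 k v) := by
  rw [entropyInt, entropyInt, ← integral_sub (integrable_entropy k v) (integrable_entropy k u),
    L2.inner_eq]
  refine integral_mono_ae ((integrable_entropy k v).sub (integrable_entropy k u))
    (L2.integrable_mul _ _) ?_
  filter_upwards [Lp.coeFn_sub v u, coeFn_truncL2 k v] with x h1 h2
  rw [h1, h2, Pi.sub_apply, mul_comm]
  exact entropy_sub_le k _ _

lemma abs_entropyInt_sub_le (k : ℝ) (u v : L2) :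
    |entropyInt k v - entropyInt k u| ≤ (‖u‖ + ‖v‖) * ‖v - u‖ := by
  have h1 : |entropyInt k v - entropyInt k u| ≤ inner ℝ (|u| + |v|) |v - u| := by
    rw [entropyInt, entropyInt, ← integral_sub (integrable_entropy k v) (integrable_entropy k u),
      L2.inner_eq]
    refine abs_integral_le_integral_abs.trans (integral_mono_ae
      ((integrable_entropy k v).sub (integrable_entropy k u)).abs (L2.integrable_mul _ _) ?_)
    filter_upwards [Lp.coeFn_sub v u, Lp.coeFn_add |u| |v|, Lp.coeFn_abs u, Lp.coeFn_abs v,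
      Lp.coeFn_abs (v - u)] with x h1 h2 h3 h4 h5
    rw [h2, Pi.add_apply, h3, h4, h5, h1, Pi.sub_apply]
    exact abs_entropy_sub_le k _ _
  refine h1.trans ((real_inner_le_norm _ _).trans ?_)
  rw [norm_abs_eq_norm]
  refine mul_le_mul_of_nonneg_right ?_ (norm_nonneg _)
  exact (norm_add_le _ _).trans_eq (by rw [norm_abs_eq_norm, norm_abs_eq_norm])

lemma continuous_entropyInt (k : ℝ) : Continuous (entropyInt k) := by
  rw [continuous_iff_continuousAt]
  intro u
  rw [ContinuousAt, tendsto_iff_norm_sub_tendsto_zero]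
  have h : Tendsto (fun v : L2 => (‖u‖ + ‖v‖) * ‖v - u‖) (𝓝 u) (𝓝 0) := by
    have : Continuous fun v : L2 => (‖u‖ + ‖v‖) * ‖v - u‖ := by fun_prop
    simpa using this.tendsto u
  exact squeeze_zero (fun _ => norm_nonneg _) (fun v => abs_entropyInt_sub_le k u v) h

lemma entropyInt_eq_zero_iff {k : ℝ} (hk : 0 ≤ k) (u : L2) :
    entropyInt k u = 0 ↔ ∀ᵐ x ∂unitMeasure, u x ≤ k := by
  rw [entropyInt, integral_eq_zero_iff_of_nonneg (fun x => entropy_nonneg k _)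
    (integrable_entropy k u)]
  refine ⟨fun h => ?_, fun h => ?_⟩
  · filter_upwards [h] with x hx
    exact le_of_entropy_eq_zero hk hx
  · filter_upwards [h] with x hx
    exact entropy_eq_zero hk hx

/-- The spatial energy estimate: diffusion absorbs transport up to a multiple of the entropy. -/
lemma neg_inner_dx_trunc_add_transport_le {k A : ℝ} (hk : 0 ≤ k) (α : L2)
    (hα : ∀ᵐ x ∂unitMeasure, |α x| ≤ A) (u : H1per) :
    -inner ℝ (H1per.dx u) (H1per.dx (H1per.trunc k u)) +
      ∫ x in Ioo (0 : ℝ) 1, α x * H1per.dx u x * H1per.toL2 (H1per.trunc k u) x ≤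
    A ^ 2 / 2 * entropyInt k (H1per.toL2 u) := by
  rw [L2.inner_eq, entropyInt, ← integral_neg, ← integral_const_mul, H1per.toL2_trunc,
    H1per.dx_trunc]
  have hi : Integrable (fun x => α x * H1per.dx u x * truncL2 k (H1per.toL2 u) x) unitMeasure := by
    have := (L2.integrable_mul (H1per.dx u) (truncL2 k (H1per.toL2 u))).bdd_mul (c := A)
      (Lp.aestronglyMeasurable α) hα
    simpa only [mul_assoc] using this
  have hn : Integrable (fun x => -(H1per.dx u x * rampMul k (H1per.toL2 u) (H1per.dx u) x))
      unitMeasure := (L2.integrable_mul (H1per.dx u) (rampMul k (H1per.toL2 u) (H1per.dx u))).neg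
  rw [← integral_add hn hi]
  refine integral_mono_ae (hn.add hi) ((integrable_entropy k _).const_mul _) ?_
  filter_upwards [hα, coeFn_rampMul k (H1per.toL2 u) (H1per.dx u), coeFn_truncL2 k (H1per.toL2 u)]
    with x h1 h2 h3
  simp only [h2, h3]
  exact neg_dissipation_add_transport_le hk h1

/-! ### The entropy inequality for weak solutions -/

lemma toDualH1per_apply (u : L2) (z : H1per) :
    toDualH1per u z = inner ℝ u (H1per.toL2 z) := rfl

lemma continuous_innerSL_comp {H V : Type*} [NormedAddCommGroup H] [InnerProductSpace ℝ H]
    [NormedAddCommGroup V] [NormedSpace ℝ V] (L : V →L[ℝ] H) :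
    Continuous fun u : H => (innerSL ℝ u).comp L :=
  ((ContinuousLinearMap.compL ℝ V H ℝ).flip L).continuous.comp (innerSL ℝ).continuous

lemma continuous_toDualH1per : Continuous toDualH1per := continuous_innerSL_comp H1per.toL2

lemma IsWeakSolution.continuousOn {a : ℝ → Hdot1} {y₀ : L2} {y : ℝ → L2}
    (hy : IsWeakSolution a y₀ y) : ContinuousOn y (Ici 0) := hy.1

lemma continuous_entropyInt_comp {y : ℝ → L2} (hy : ContinuousOn y (Ici 0)) (k : ℝ) :
    Continuous fun t => entropyInt k (y (max t 0)) :=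
  (continuous_entropyInt k).comp
    (hy.comp_continuous (by fun_prop) fun t => mem_Ici.2 (le_max_right _ _))

/-- The integrated entropy inequality, away from the initial time. -/
lemma IsWeakSolution.entropyInt_le {a : ℝ → Hdot1} {y₀ : L2} {y : ℝ → L2}
    (hy : IsWeakSolution a y₀ y) {k A s T : ℝ} (hk : 0 ≤ k) (hs : 0 < s) (hsT : s ≤ T)
    (hA : ∀ t ∈ Icc s T, ∀ᵐ x ∂unitMeasure, |H1per.toL2 (a t : H1per) x| ≤ A) :
    entropyInt k (y T) ≤
      entropyInt k (y s) + A ^ 2 / 2 * ∫ t in s..T, entropyInt k (y (max t 0)) := by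
  obtain ⟨hyc, -, Y, D, hY, hYy, hD, hDy, heq⟩ := hy
  have hFc := continuous_entropyInt_comp hyc k
  have hsub : Ioc s T ⊆ Ioi 0 := fun t ht => hs.trans ht.1
  have hWL : MemLp (fun t => H1per.trunc k (Y t)) 2 (volume.restrict (Ioc s T)) := by
    have hsub' : Ioc s T ⊆ Icc s (T + 1) := fun t ht => ⟨ht.1.le, ht.2.trans (by linarith)⟩
    have hYL : MemLp Y 2 (volume.restrict (Ioc s T)) :=
      (hY s (T + 1) hs (by linarith)).mono_measure (Measure.restrict_mono hsub' le_rfl)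
    exact hYL.of_le ((H1per.continuous_trunc k).comp_aestronglyMeasurable hYL.aestronglyMeasurable)
      (.of_forall fun t => H1per.norm_trunc_le k (Y t))
  have hinc : ∀ h ∈ Ioo 0 (s / 2), ∀ᵐ t ∂(volume.restrict (Ioc s T)),
      entropyInt k (y (max t 0)) - entropyInt k (y (max (t - h) 0)) ≤
        ∫ r in (t - h)..t, D r (H1per.trunc k (Y t)) := by
    intro h hh
    filter_upwards [ae_restrict_mem measurableSet_Ioc,
      ae_restrict_of_ae_restrict_of_subset hsub hYy] with t ht hyt
    have h1 : 0 < t - h := by linarith [ht.1, hh.2]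
    rw [max_eq_left h1.le, max_eq_left (hs.trans ht.1).le]
    refine (entropyInt_sub_le k _ _).trans_eq ?_
    have h2 := hDy.sub_eq_integral (continuous_toDualH1per.comp_continuousOn hyc) hD h1
      (by linarith [hh.1] : t - h ≤ t) (H1per.trunc k (Y t))
    rw [Function.comp_apply, Function.comp_apply, toDualH1per_apply, toDualH1per_apply,
      H1per.toL2_trunc, hyt, ← inner_sub_left] at h2
    exact h2
  obtain ⟨hint, hmain⟩ := sub_le_setIntegral_pairing hFc hsT (δ := s / 2) (by positivity)
    (hD (s - s / 2) T (by linarith) (by linarith)) hWL hinc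
  have hpair : ∫ t in Ioc s T, D t (H1per.trunc k (Y t)) ≤
      ∫ t in Ioc s T, A ^ 2 / 2 * entropyInt k (y (max t 0)) := by
    refine integral_mono_ae hint (hFc.integrableOn_Ioc.const_mul _) ?_
    filter_upwards [ae_restrict_mem measurableSet_Ioc, ae_restrict_of_ae_restrict_of_subset hsub
      hYy, ae_restrict_of_ae_restrict_of_subset hsub heq] with t ht hyt hteq
    have h1 := hteq (H1per.trunc k (Y t))
    have h2 := neg_inner_dx_trunc_add_transport_le hk (H1per.toL2 (a t : H1per))
      (hA t ⟨ht.1.le, ht.2⟩) (Y t)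
    rw [max_eq_left (hs.trans ht.1).le, ← hyt]
    linarith
  rw [integral_const_mul] at hpair
  rw [intervalIntegral.integral_of_le hsT]
  rw [max_eq_left (hs.le.trans hsT), max_eq_left hs.le] at hmain
  linarith

/-- The integral form of Gronwall's inequality with zero initial value. -/
lemma nonpos_of_le_mul_integral {F : ℝ → ℝ} (hF : Continuous F) {K T : ℝ} (hK : 0 ≤ K)
    (h : ∀ t ∈ Icc 0 T, F t ≤ K * ∫ r in (0 : ℝ)..t, F r) {t : ℝ} (ht : t ∈ Icc 0 T) :
    F t ≤ 0 := by
  have hE : ∀ x, HasDerivAt (fun x => ∫ r in (0 : ℝ)..x, F r) (F x) x := fun x =>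
    intervalIntegral.integral_hasDerivAt_right (hF.intervalIntegrable _ _)
      hF.aestronglyMeasurable.stronglyMeasurableAtFilter hF.continuousAt
  set G : ℝ → ℝ := fun x => Real.exp (-K * x) * ∫ r in (0 : ℝ)..x, F r with hG
  have hGd : ∀ x, HasDerivAt G
      (Real.exp (-K * x) * (-K) * (∫ r in (0 : ℝ)..x, F r) + Real.exp (-K * x) * F x) x :=
    fun x => by
      have h1 : HasDerivAt (fun x : ℝ => -K * x) (-K) x := by
        simpa using (hasDerivAt_id x).const_mul (-K)
      exact h1.exp.mul (hE x)
  have hanti : AntitoneOn G (Icc 0 T) := by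
    refine antitoneOn_of_deriv_nonpos (convex_Icc 0 T)
      (fun x _ => (hGd x).continuousAt.continuousWithinAt)
      (fun x _ => (hGd x).differentiableAt.differentiableWithinAt) fun x hx => ?_
    rw [(hGd x).deriv]
    have h1 := h x (interior_subset hx)
    have h2 := Real.exp_pos (-K * x)
    nlinarith
  have h1 : G t ≤ G 0 := hanti ⟨le_rfl, ht.1.trans ht.2⟩ ht ht.1
  have h2 : G 0 = 0 := by simp [hG]
  have h3 : ∫ r in (0 : ℝ)..t, F r ≤ 0 := by
    rw [h2] at h1
    exact nonpos_of_mul_nonpos_right h1 (Real.exp_pos _)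
  exact (h t ht).trans (mul_nonpos_of_nonneg_of_nonpos hK h3)

/-- The one-sided maximum principle. -/
lemma IsWeakSolution.ae_le {a : ℝ → Hdot1} (ha : ContinuousOn a (Ici 0)) {y₀ : L2} {y : ℝ → L2}
    (hy : IsWeakSolution a y₀ y) {k : ℝ} (hk : 0 ≤ k) (hk₀ : ∀ᵐ x ∂unitMeasure, y₀ x ≤ k)
    {τ : ℝ} (hτ : 0 ≤ τ) : ∀ᵐ x ∂unitMeasure, y τ x ≤ k := by
  have hFc := continuous_entropyInt_comp hy.continuousOn k
  set F : ℝ → ℝ := fun t => entropyInt k (y (max t 0)) with hF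
  have hF0 : F 0 = 0 := by
    simp only [hF, max_self, hy.2.1]
    exact (entropyInt_eq_zero_iff hk y₀).2 hk₀
  -- On `[0, τ]` the coefficient is bounded in `H1per`, hence in `L^∞`.
  obtain ⟨C, hC⟩ := (isCompact_Icc (a := (0 : ℝ)) (b := τ)).exists_bound_of_continuousOn
    (ha.mono Icc_subset_Ici_self)
  have hA : ∀ t ∈ Icc 0 τ, ∀ᵐ x ∂unitMeasure, |H1per.toL2 (a t : H1per) x| ≤ 2 * C := by
    intro t ht
    filter_upwards [H1per.ae_abs_le (a t : H1per)] with x hx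
    have h1 := H1per.norm_toL2_le (a t : H1per)
    have h2 := H1per.norm_dx_le (a t : H1per)
    have h3 : ‖(a t : H1per)‖ ≤ C := hC t ht
    linarith
  have hineq : ∀ t ∈ Icc 0 τ, F t ≤ (2 * C) ^ 2 / 2 * ∫ r in (0 : ℝ)..t, F r := by
    intro t ht
    rcases ht.1.eq_or_lt with h0 | h0
    · rw [← h0, hF0]
      simp
    -- The entropy inequality holds on `[s, t]` for all `s > 0`; by continuity also for `s = 0`.
    have hlim : Continuous fun s => F s + (2 * C) ^ 2 / 2 * ∫ r in s..t, F r := by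
      have : Continuous fun s => ∫ r in s..t, F r := by
        simp_rw [intervalIntegral.integral_symm t]
        exact (intervalIntegral.continuous_primitive (fun x y => hFc.intervalIntegrable x y) t).neg
      fun_prop
    have hl := (hlim.tendsto 0).mono_left (nhdsWithin_le_nhds (s := Ioi 0))
    rw [hF0, zero_add] at hl
    refine ge_of_tendsto hl ?_
    filter_upwards [Ioc_mem_nhdsGT h0] with s hs
    have := hy.entropyInt_le hk hs.1 hs.2 fun r hr => hA r ⟨hs.1.le.trans hr.1, hr.2.trans ht.2⟩
    simpa only [hF, max_eq_left ht.1, max_eq_left hs.1.le] using this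
  have hfin := nonpos_of_le_mul_integral hFc (by positivity) hineq ⟨hτ, le_rfl⟩
  simp only [hF, max_eq_left hτ] at hfin
  exact (entropyInt_eq_zero_iff hk _).1 (le_antisymm hfin (entropyInt_nonneg _ _))

lemma toDualH1per_neg (u : L2) : toDualH1per (-u) = -toDualH1per u := by
  simp [toDualH1per]

/-- The problem is linear. -/
lemma IsWeakSolution.neg {a : ℝ → Hdot1} {y₀ : L2} {y : ℝ → L2} (hy : IsWeakSolution a y₀ y) :
    IsWeakSolution a (-y₀) fun τ => -y τ := by
  obtain ⟨hyc, hy0, Y, D, hY, hYy, hD, hDy, heq⟩ := hy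
  refine ⟨hyc.neg, congrArg Neg.neg hy0, fun τ => -Y τ, fun τ => -D τ,
    fun s t hs hst => (hY s t hs hst).neg, ?_, fun s t hs hst => (hD s t hs hst).neg, ?_, ?_⟩
  · filter_upwards [hYy] with τ h
    rw [map_neg, h]
  · intro φ hφ hc hs
    simp only [toDualH1per_neg, smul_neg, integral_neg, hDy φ hφ hc hs]
  · filter_upwards [heq] with τ h z
    have h1 : ∫ x in Ioo (0 : ℝ) 1,
          H1per.toL2 (a τ : H1per) x * H1per.dx (-Y τ) x * H1per.toL2 z x =
        -∫ x in Ioo (0 : ℝ) 1, H1per.toL2 (a τ : H1per) x * H1per.dx (Y τ) x * H1per.toL2 z x := by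
      rw [← integral_neg]
      refine integral_congr_ae ?_
      filter_upwards [Lp.coeFn_neg (H1per.dx (Y τ))] with x hx
      rw [map_neg, hx, Pi.neg_apply]
      ring
    rw [h1, map_neg, inner_neg_left, neg_apply]
    linarith [h z]

theorem mainTheorem7 (M : ℝ) (a : ℝ → Hdot1) (ha : ContinuousOn a (Ici 0))
    (haM : ∀ τ : ℝ, 0 ≤ τ → Hdot1.homNorm (a τ) ≤ M)
    (y₀ : L2) (hy₀ : MemLp y₀ ⊤ unitMeasure)
    (y : ℝ → L2) (hy : IsWeakSolution a y₀ y) :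
    ∀ τ : ℝ, 0 ≤ τ → eLpNorm (y τ) ⊤ unitMeasure ≤ eLpNorm y₀ ⊤ unitMeasure := by
  intro τ hτ
  set k : ℝ := (eLpNorm y₀ ⊤ unitMeasure).toReal with hk
  have hk0 : 0 ≤ k := ENNReal.toReal_nonneg
  have hke : eLpNorm y₀ ⊤ unitMeasure = ENNReal.ofReal k :=
    (ENNReal.ofReal_toReal hy₀.eLpNorm_ne_top).symm
  have hb : ∀ᵐ x ∂unitMeasure, |y₀ x| ≤ k := by
    filter_upwards [ae_le_eLpNormEssSup (f := y₀) (μ := unitMeasure)] with x hx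
    rw [← eLpNorm_exponent_top, hke, Real.enorm_eq_ofReal_abs] at hx
    exact (ENNReal.ofReal_le_ofReal_iff hk0).1 hx
  have h1 := hy.ae_le ha hk0 (hb.mono fun x hx => (abs_le.1 hx).2) hτ
  have h2 := hy.neg.ae_le ha hk0 (by
    filter_upwards [hb, Lp.coeFn_neg y₀] with x hx hn
    rw [hn, Pi.neg_apply]
    linarith [(abs_le.1 hx).1]) hτ
  rw [hke, eLpNorm_exponent_top]
  refine eLpNormEssSup_le_of_ae_bound ?_
  filter_upwards [h1, h2, Lp.coeFn_neg (y τ)] with x hx1 hx2 hn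
  rw [hn, Pi.neg_apply] at hx2
  rw [Real.norm_eq_abs, abs_le]
  exact ⟨by linarith, hx1⟩
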